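/- Consider propositional formulas built from countably many variables with $\neg,\wedge,\vee,\to$. Let $\varphi_1=\neg p_1\vee\neg\neg p_1$, and for $k>1$ let $$\varphi_k=\bigvee_{i\neq j}\big(\neg p_i\to\neg p_j\big)\;\vee\;\neg(\neg p_1\wedge\dots\wedge\neg p_k)\qquad(1\le i,j\le k).$$ Let ${\sf IPC}+\varphi_k$ be the closure under modus ponens of intuitionistic propositional logic ${\sf IPC}$ together with all substitution instances of $\varphi_k$. A Kripke frame is a partially ordered set with a least element (root). It has topwidth $m$ if it has $m$ distinct maximal nodes such that every node lies below at least one of them. A formula holds in a frame if it is forced at every node under every (upward closed) valuation. Theorem. Let $k\ge 1$ and let $n$ be the least integer $n\geq 1$ such that $\binom{n}{\lfloor n/2\rfloor}\ge k$. Then ${\sf IPC}+\varphi_k$ is complete with respect to the class of finite Kripke frames of topwidth at most $n$; that is, a formula is derivable in ${\sf IPC}+\varphi_k$ if and only if it holds in every finite Kripke frame of topwidth at most $n$. Moreover, for each $k\ge 1$, ${\sf IPC}+\varphi_k$ is decidable, i.e. its set of theorems is computable. -/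

import Mathlib

universe u

namespace IntProp

/-- Propositional formulas over the variables `var 0, var 1, …`, built with `¬, ∧, ∨, →`. -/
inductive Formula : Type
  | var (i : ℕ) : Formula
  | neg (A : Formula) : Formula
  | and (A B : Formula) : Formula
  | or (A B : Formula) : Formula
  | imp (A B : Formula) : Formula

namespace Formula

/-- Simultaneous substitution of the formulas `s i` for the variables `var i`. -/
def subst (s : ℕ → Formula) : Formula → Formula
  | var i => s i
  | neg A => neg (A.subst s)
  | and A B => and (A.subst s) (B.subst s)
  | or A B => or (A.subst s) (B.subst s)
  | imp A B => imp (A.subst s) (B.subst s)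

/-- The standard Gödel numbering of formulas. -/
def code : Formula → ℕ
  | var i => 5 * i
  | neg A => 5 * A.code + 1
  | and A B => 5 * Nat.pair A.code B.code + 2
  | or A B => 5 * Nat.pair A.code B.code + 3
  | imp A B => 5 * Nat.pair A.code B.code + 4

/-- The inverse of `code`. -/
def ofCode (m : ℕ) : Formula :=
  if h0 : m % 5 = 0 then var (m / 5)
  else
    have h : m / 5 < m := Nat.div_lt_self (by omega) (by omega)
    have h1 : (m / 5).unpair.1 < m := lt_of_le_of_lt (Nat.unpair_left_le _) h
    have h2 : (m / 5).unpair.2 < m := lt_of_le_of_lt (Nat.unpair_right_le _) h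
    if m % 5 = 1 then neg (ofCode (m / 5))
    else if m % 5 = 2 then and (ofCode (m / 5).unpair.1) (ofCode (m / 5).unpair.2)
    else if m % 5 = 3 then or (ofCode (m / 5).unpair.1) (ofCode (m / 5).unpair.2)
    else imp (ofCode (m / 5).unpair.1) (ofCode (m / 5).unpair.2)
termination_by m

theorem ofCode_code (A : Formula) : ofCode A.code = A := by
  induction A with
  | var i => rw [code, ofCode]; simp
  | neg A ih =>
    rw [code, ofCode, dif_neg (by omega), if_pos (by omega),
      show (5 * A.code + 1) / 5 = A.code by omega, ih]
  | and A B ihA ihB =>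
    rw [code, ofCode, dif_neg (by omega), if_neg (by omega), if_pos (by omega),
      show (5 * Nat.pair A.code B.code + 2) / 5 = Nat.pair A.code B.code by omega,
      Nat.unpair_pair, ihA, ihB]
  | or A B ihA ihB =>
    rw [code, ofCode, dif_neg (by omega), if_neg (by omega), if_neg (by omega),
      if_pos (by omega),
      show (5 * Nat.pair A.code B.code + 3) / 5 = Nat.pair A.code B.code by omega,
      Nat.unpair_pair, ihA, ihB]
  | imp A B ihA ihB =>
    rw [code, ofCode, dif_neg (by omega), if_neg (by omega), if_neg (by omega),
      if_neg (by omega),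
      show (5 * Nat.pair A.code B.code + 4) / 5 = Nat.pair A.code B.code by omega,
      Nat.unpair_pair, ihA, ihB]

theorem code_ofCode (m : ℕ) : (ofCode m).code = m := by
  induction m using Nat.strong_induction_on with
  | _ m ih =>
    by_cases h0 : m % 5 = 0
    · rw [ofCode, dif_pos h0, code]; omega
    · have h : m / 5 < m := Nat.div_lt_self (by omega) (by omega)
      have ih0 := ih _ h
      have ih1 := ih _ (lt_of_le_of_lt (Nat.unpair_left_le _) h)
      have ih2 := ih _ (lt_of_le_of_lt (Nat.unpair_right_le _) h)
      rw [ofCode, dif_neg h0]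
      dsimp only
      split_ifs <;> simp only [code, ih0, ih1, ih2, Nat.pair_unpair] <;> omega

/-- The Gödel numbering is a bijection between formulas and natural numbers; it fixes what it
means for a set of formulas to be computable. -/
instance : Denumerable Formula :=
  Denumerable.mk' ⟨code, ofCode, ofCode_code, code_ofCode⟩

/-- `¬p₁ ∧ … ∧ ¬p_k` for `k ≥ 1`, where `p_{i+1}` is `var i` (and `¬p₁` for `k = 0`). -/
def conjNeg (k : ℕ) : Formula :=
  ((List.range' 1 (k - 1)).map fun i => neg (var i)).foldl and (neg (var 0))

/-- The formulas `¬p_i → ¬p_j` with `i ≠ j` and `1 ≤ i, j ≤ k`, where `p_{i+1}` is `var i`. -/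
def negImps (k : ℕ) : List Formula :=
  ((List.range k ×ˢ List.range k).filter fun ij => ij.1 ≠ ij.2).map
    fun ij => imp (neg (var ij.1)) (neg (var ij.2))

/-- The formula `φ_k` (for `k ≥ 1`): `φ₁ = ¬p ∨ ¬¬p`, and for `k > 1`
`φ_k = ⋁_{i ≠ j} (¬p_i → ¬p_j) ∨ ¬(¬p₁ ∧ … ∧ ¬p_k)`. The value at `k = 0` is irrelevant. -/
def phi (k : ℕ) : Formula :=
  if k = 1 then or (neg (var 0)) (neg (neg (var 0)))
  else (negImps k).foldr or (neg (conjNeg k))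

end Formula

open Formula in
/-- The axioms of a standard Hilbert calculus for intuitionistic propositional logic `IPC`. -/
inductive IPCAxiom : Formula → Prop
  | k (A B : Formula) : IPCAxiom (imp A (imp B A))
  | s (A B C : Formula) :
      IPCAxiom (imp (imp A (imp B C)) (imp (imp A B) (imp A C)))
  | and_intro (A B : Formula) : IPCAxiom (imp A (imp B (and A B)))
  | and_left (A B : Formula) : IPCAxiom (imp (and A B) A)
  | and_right (A B : Formula) : IPCAxiom (imp (and A B) B)
  | or_left (A B : Formula) : IPCAxiom (imp A (or A B))
  | or_right (A B : Formula) : IPCAxiom (imp B (or A B))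
  | or_elim (A B C : Formula) :
      IPCAxiom (imp (imp A C) (imp (imp B C) (imp (or A B) C)))
  | neg_intro (A B : Formula) :
      IPCAxiom (imp (imp A B) (imp (imp A (neg B)) (neg A)))
  | neg_elim (A B : Formula) : IPCAxiom (imp (neg A) (imp A B))

/-- `Derivable X A`: the formula `A` is derivable in the logic `IPC + X`, the closure under modus
ponens of the axioms of `IPC` and all substitution instances of the formula `X`. -/
inductive Derivable (X : Formula) : Formula → Prop
  | ipc {A : Formula} (h : IPCAxiom A) : Derivable X A
  | inst (s : ℕ → Formula) : Derivable X (X.subst s)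
  | mp {A B : Formula} (h : Derivable X (Formula.imp A B)) (h' : Derivable X A) : Derivable X B

/-- A Kripke frame: a partially ordered set with a root, i.e. a least element. -/
structure KripkeFrame : Type (u + 1) where
  carrier : Type u
  [order : PartialOrder carrier]
  exists_root : ∃ r : carrier, ∀ x : carrier, r ≤ x

attribute [instance] KripkeFrame.order

namespace KripkeFrame

/-- A valuation on a Kripke frame associates with every variable an upward closed set of nodes. -/
structure Valuation (F : KripkeFrame.{u}) : Type u where
  val : ℕ → Set F.carrier
  mono : ∀ (i : ℕ) (x y : F.carrier), x ∈ val i → x ≤ y → y ∈ val i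

/-- The forcing relation `x ⊩ A` in the Kripke model given by a frame and a valuation. -/
def Forces {F : KripkeFrame.{u}} (V : F.Valuation) : F.carrier → Formula → Prop
  | x, .var i => x ∈ V.val i
  | x, .neg A => ¬ ∃ y, x ≤ y ∧ Forces V y A
  | x, .and A B => Forces V x A ∧ Forces V x B
  | x, .or A B => Forces V x A ∨ Forces V x B
  | x, .imp A B => ∀ y, x ≤ y → Forces V y A → Forces V y B

/-- A formula holds in a frame if it is forced at all nodes under all valuations. -/
def Holds (F : KripkeFrame.{u}) (A : Formula) : Prop :=
  ∀ (V : F.Valuation) (x : F.carrier), Forces V x A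

/-- The frame has topwidth `m`: there are `m` (distinct) maximal nodes such that every node lies
below one of them. -/
def HasTopwidth (F : KripkeFrame.{u}) (m : ℕ) : Prop :=
  ∃ x : Fin m → F.carrier, Function.Injective x ∧ (∀ i, IsMax (x i)) ∧ ∀ y, ∃ i, y ≤ x i

/-- The frame has topwidth at most `n`. -/
def TopwidthAtMost (F : KripkeFrame.{u}) (n : ℕ) : Prop :=
  ∃ m ≤ n, F.HasTopwidth m

end KripkeFrame

/-- The logic `IPC + X` is complete with respect to (characterizes) the class `𝒦` of frames: a
formula is derivable in it if and only if it holds on every frame in `𝒦`. -/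
def CompleteFor (X : Formula) (𝒦 : Set KripkeFrame.{u}) : Prop :=
  ∀ A : Formula, Derivable X A ↔ ∀ F ∈ 𝒦, F.Holds A

/-- The logic `IPC + X` is decidable: its set of theorems is computable. -/
def DecidableLogic (X : Formula) : Prop :=
  ComputablePred fun A : Formula => Derivable X A

end IntProp

/-!
Semantically, a node refuting `φ_k` amounts to an antichain: the set of maximal nodes above it that
force `¬p_i` determines which of the formulas `¬p_i → ¬p_j` and `¬(¬p₁ ∧ … ∧ ¬p_k)` are refuted, and
all are refuted iff the `k` sets are pairwise incomparable and have a common element. By Sperner's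
theorem this is possible on `m` maximal nodes (for `k > 1`) iff `k ≤ (m - 1).choose ((m - 1) / 2)`.
Hence topwidth at most `n` makes `φ_k` valid (`KripkeFrame.holds_phi`).

For completeness, let `T` be a prime theory of `IPC + φ_k` omitting an underivable formula `A`; it
exists by Zorn's lemma. If `T` had `n + 1` maximal consistent extensions, an antichain of size `k`
on the first `n`, with the last one added to each member, would define a substitution instance of
`φ_k` outside `T`, since finitely many maximal theories are separated by formulas (`not_injective_maximal`). So the
canonical model above `T` has at most `n` maximal nodes. Restricting all its theories to the
formulas with code at most that of `A`, a set closed under subformulas, gives a finite model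
ordered by inclusion. Each of its nodes is still below the restriction of a maximal theory, so its
topwidth is at most `n` (`refutable_of_not_derivable`).

The finite models so obtained have a bound computable from the code of `A`. They are coded by
natural numbers, a world being the binary representation of a set of formula codes and a model that
of a set of worlds. The relation `Refutable n A.code`, that some code of a countermodel of topwidth
at most `n` exists, then lies between refutability on finite frames and underivability, and it is
primitive recursive because all its quantifiers are bounded. This gives the completeness theorem and
decidability together.
-/

namespace IntProp

/-! ### Formulas and their substitution instances -/

namespace Formula

theorem subst_foldr_or (s : ℕ → Formula) (l : List Formula) (A : Formula) :
    (l.foldr .or A).subst s = (l.map (subst s)).foldr .or (A.subst s) := by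
  induction l with
  | nil => rfl
  | cons B l ih => simp [subst, ih]

theorem subst_foldl_and (s : ℕ → Formula) (l : List Formula) (A : Formula) :
    (l.foldl .and A).subst s = (l.map (subst s)).foldl .and (A.subst s) := by
  induction l generalizing A with
  | nil => rfl
  | cons B l ih => simp [subst, ih]

theorem mem_negImps {k : ℕ} {B : Formula} :
    B ∈ negImps k ↔ ∃ i < k, ∃ j < k, i ≠ j ∧ imp (neg (var i)) (neg (var j)) = B := by
  simp only [negImps, List.mem_map, List.mem_filter, decide_eq_true_eq, Prod.exists,
    List.mem_product, List.mem_range]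
  constructor
  · rintro ⟨i, j, ⟨⟨hi, hj⟩, hij⟩, h⟩
    exact ⟨i, hi, j, hj, hij, h⟩
  · rintro ⟨i, hi, j, hj, hij, h⟩
    exact ⟨i, j, ⟨⟨hi, hj⟩, hij⟩, h⟩

end Formula

/-! ### Forcing -/

namespace KripkeFrame

variable {F : KripkeFrame.{u}}

theorem Forces.mono {V : F.Valuation} {A : Formula} {x y : F.carrier} (hxy : x ≤ y)
    (h : Forces V x A) : Forces V y A := by
  induction A with
  | var i => exact V.mono i x y h hxy
  | neg A => exact fun ⟨z, hz, hA⟩ => h ⟨z, hxy.trans hz, hA⟩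
  | and A B ihA ihB => exact ⟨ihA h.1, ihB h.2⟩
  | or A B ihA ihB => exact h.imp ihA ihB
  | imp A B => exact fun z hz hA => h z (hxy.trans hz) hA

/-- The valuation sending `var i` to the nodes that force `s i`. -/
def Valuation.subst (V : F.Valuation) (s : ℕ → Formula) : F.Valuation where
  val i := {x | Forces V x (s i)}
  mono _ _ _ h hxy := Forces.mono hxy h

theorem forces_subst (V : F.Valuation) (s : ℕ → Formula) (A : Formula) (x : F.carrier) :
    Forces V x (A.subst s) ↔ Forces (V.subst s) x A := by
  induction A generalizing x with
  | var i => rfl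
  | neg A ih => simp only [Formula.subst, Forces, ih]
  | and A B ihA ihB => simp only [Formula.subst, Forces, ihA, ihB]
  | or A B ihA ihB => simp only [Formula.subst, Forces, ihA, ihB]
  | imp A B ihA ihB => simp only [Formula.subst, Forces, ihA, ihB]

theorem holds_of_ipcAxiom {A : Formula} (h : IPCAxiom A) : F.Holds A := by
  intro V x
  cases h with
  | k A B => exact fun y _ hA z hyz _ => hA.mono hyz
  | s A B C =>
    exact fun y _ h z hyz h' w hzw hA => h w (hyz.trans hzw) hA w le_rfl (h' w hzw hA)
  | and_intro A B => exact fun y _ hA z hyz hB => ⟨hA.mono hyz, hB⟩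
  | and_left A B => exact fun y _ h => h.1
  | and_right A B => exact fun y _ h => h.2
  | or_left A B => exact fun y _ h => Or.inl h
  | or_right A B => exact fun y _ h => Or.inr h
  | or_elim A B C =>
    exact fun y _ hA z hyz hB w hzw h =>
      h.elim (hA w (hyz.trans hzw)) (hB w hzw)
  | neg_intro A B =>
    exact fun y _ h z hyz h' ⟨w, hzw, hA⟩ =>
      h' w hzw hA ⟨w, le_rfl, h w (hyz.trans hzw) hA⟩
  | neg_elim A B => exact fun y _ h z hyz hA => (h ⟨z, hyz, hA⟩).elim

theorem holds_of_derivable {X A : Formula} (hX : F.Holds X) (h : Derivable X A) : F.Holds A := by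
  induction h with
  | ipc h => exact holds_of_ipcAxiom h
  | inst s => exact fun V x => (forces_subst V s X x).2 (hX _ x)
  | mp _ _ ih ih' => exact fun V x => ih V x x le_rfl (ih' V x)

theorem forces_foldr_or {V : F.Valuation} {x : F.carrier} {l : List Formula} {A : Formula} :
    Forces V x (l.foldr .or A) ↔ (∃ B ∈ l, Forces V x B) ∨ Forces V x A := by
  induction l with
  | nil => simp
  | cons B l ih => simp [Forces, ih, or_assoc]

theorem forces_foldl_and {V : F.Valuation} {x : F.carrier} {l : List Formula} {A : Formula} :
    Forces V x (l.foldl .and A) ↔ Forces V x A ∧ ∀ B ∈ l, Forces V x B := by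
  induction l generalizing A with
  | nil => simp
  | cons B l ih => simp [Forces, ih, and_assoc]

theorem forces_conjNeg {V : F.Valuation} {x : F.carrier} {k i : ℕ} (hi : i < k)
    (h : Forces V x (Formula.conjNeg k)) : Forces V x (.neg (.var i)) := by
  rw [Formula.conjNeg, forces_foldl_and] at h
  rcases Nat.eq_zero_or_pos i with rfl | hpos
  · exact h.1
  · exact h.2 _ (List.mem_map.2 ⟨i, List.mem_range'_1.2 ⟨hpos, by omega⟩, rfl⟩)

/-! ### Topwidth and the validity of `φ_k` -/

theorem holds_phi_one (h : F.HasTopwidth 1) : F.Holds (Formula.phi 1) := by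
  obtain ⟨t, -, -, ht⟩ := h
  have le_top (y : F.carrier) : y ≤ t 0 := by
    obtain ⟨i, hi⟩ := ht y
    rwa [Fin.fin_one_eq_zero i] at hi
  intro V x
  rw [Formula.phi, if_pos rfl]
  by_cases h0 : Forces V (t 0) (.var 0)
  · exact Or.inr fun ⟨y, _, hy⟩ => hy ⟨t 0, le_top y, h0⟩
  · exact Or.inl fun ⟨y, _, hy⟩ => h0 (hy.mono (le_top y))

/-- A node refuting `φ_k` yields `k` pairwise incomparable sets of maximal nodes, the `i`-th
consisting of the maximal nodes above it that force `¬p_i`, and all of them share a maximal node.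
Deleting the latter leaves an antichain of size `k` on `m - 1` points. -/
theorem le_choose_of_not_holds_phi {m k : ℕ} (hF : F.HasTopwidth m) (hk : k ≠ 1)
    (h : ¬ F.Holds (Formula.phi k)) : k ≤ (m - 1).choose ((m - 1) / 2) := by
  classical
  obtain ⟨t, -, tmax, ht⟩ := hF
  simp only [Holds, not_forall] at h
  obtain ⟨V, x, hx⟩ := h
  rw [Formula.phi, if_neg hk, forces_foldr_or] at hx
  simp only [not_or, not_exists, not_and] at hx
  obtain ⟨hx₁, hx₂⟩ := hx
  obtain ⟨z, hxz, hz⟩ := not_not.1 hx₂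
  obtain ⟨l, hl⟩ := ht z
  let T (i : Fin k) : Finset {j : Fin m // j ≠ l} :=
    {j | x ≤ t j ∧ Forces V (t j) (.neg (.var i))}
  have hT (i j : Fin k) (hij : i ≠ j) : ¬ T i ⊆ T j := by
    intro hsub
    refine hx₁ _ (Formula.mem_negImps.2 ⟨i, i.2, j, j.2, fun e => hij (Fin.ext e), rfl⟩) ?_
    rintro y hxy hy ⟨w, hyw, hw⟩
    obtain ⟨q, hq⟩ := ht w
    have hyq : y ≤ t q := hyw.trans hq
    have hql : q ≠ l := by
      rintro rfl
      exact forces_conjNeg j.2 (hz.mono hl) ⟨t q, le_rfl, hw.mono hq⟩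
    have hmem : (⟨q, hql⟩ : {j : Fin m // j ≠ l}) ∈ T j :=
      hsub (by simpa [T] using ⟨hxy.trans hyq, hy.mono hyq⟩)
    exact (by simpa [T] using hmem : _ ∧ Forces V (t q) (.neg (.var j))).2
      ⟨t q, le_rfl, hw.mono hq⟩
  have hinj : Function.Injective T := fun i j e => by
    by_contra hij
    exact hT i j hij e.le
  have hanti : IsAntichain (· ⊆ ·) (SetLike.coe (Finset.univ.image T)) := by
    rintro _ hA _ hB hne hsub
    obtain ⟨i, -, rfl⟩ := Finset.mem_image.1 (Finset.mem_coe.1 hA)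
    obtain ⟨j, -, rfl⟩ := Finset.mem_image.1 (Finset.mem_coe.1 hB)
    exact hT i j (fun e => hne (congrArg T e)) hsub
  have hs := hanti.sperner
  rw [Finset.card_image_of_injective _ hinj] at hs
  simpa [Fintype.card_subtype_compl] using hs

theorem holds_phi {n k : ℕ} (hk : 1 ≤ k)
    (hn : IsLeast {m : ℕ | 1 ≤ m ∧ k ≤ m.choose (m / 2)} n)
    (hF : F.TopwidthAtMost n) : F.Holds (Formula.phi k) := by
  obtain ⟨m, hmn, hm⟩ := hF
  have hpos : 0 < m := by
    obtain ⟨r, -⟩ := F.exists_root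
    obtain ⟨t, -, -, ht⟩ := hm
    obtain ⟨i, -⟩ := ht r
    exact i.pos
  rcases eq_or_ne k 1 with rfl | hk1
  · have hn1 : n ≤ 1 := hn.2 ⟨le_rfl, by simp⟩
    obtain rfl : m = 1 := by omega
    exact holds_phi_one hm
  · by_contra h
    have hle := le_choose_of_not_holds_phi hm hk1 h
    by_cases hm1 : m = 1
    · rw [hm1] at hle
      simp at hle
      omega
    · have := hn.2 (show m - 1 ∈ {m : ℕ | 1 ≤ m ∧ k ≤ m.choose (m / 2)} from ⟨by omega, hle⟩)
      omega

/-- A finite frame whose nodes all lie below one of `n` given nodes has topwidth at most `n`. -/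
theorem topwidthAtMost_of_cofinal [Finite F.carrier] {n : ℕ} (f : Fin n → F.carrier)
    (hf : ∀ y, ∃ i, y ≤ f i) : F.TopwidthAtMost n := by
  have hsub : {x : F.carrier | IsMax x} ⊆ Set.range f := fun x hx => by
    obtain ⟨i, hi⟩ := hf x
    exact ⟨i, (hx.eq_of_le hi).symm⟩
  refine ⟨{x : F.carrier | IsMax x}.ncard, ?_, ?_⟩
  · calc _ ≤ (Set.range f).ncard := Set.ncard_le_ncard hsub (Set.toFinite _)
      _ ≤ Nat.card (Fin n) := by
        rw [← Set.image_univ, ← Set.ncard_univ]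
        exact Set.ncard_image_le (Set.toFinite _)
      _ = n := Nat.card_fin n
  · let e : Fin {x : F.carrier | IsMax x}.ncard ≃ {x : F.carrier | IsMax x} :=
      (Finite.equivFin {x : F.carrier | IsMax x}).symm
    refine ⟨fun i => (e i).1, Subtype.val_injective.comp e.injective, fun i => (e i).2, ?_⟩
    intro y
    obtain ⟨z, hyz, hz⟩ :=
      (Set.toFinite (Set.univ : Set F.carrier)).exists_le_maximal (Set.mem_univ y)
    refine ⟨e.symm ⟨z, maximal_true.1 (by simpa using hz)⟩, by simpa using hyz⟩

end KripkeFrame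

/-! ### Theories, prime theories and maximal theories -/

/-- A theory over `IPC + X`: a set of formulas that contains all theorems of `IPC + X` and is
closed under modus ponens. -/
structure IsTheory (X : Formula) (T : Set Formula) : Prop where
  thm {A : Formula} : Derivable X A → A ∈ T
  mp {A B : Formula} : Formula.imp A B ∈ T → A ∈ T → B ∈ T

/-- A prime theory: a consistent theory with the disjunction property. -/
structure IsPrimeTheory (X : Formula) (T : Set Formula) : Prop extends IsTheory X T where
  proper : ∃ A, A ∉ T
  prime {A B : Formula} : Formula.or A B ∈ T → A ∈ T ∨ B ∈ T

/-- A theory that is maximal among those omitting the formula `A`. -/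
def MaximalOmitting (X A : Formula) (T : Set Formula) : Prop :=
  Maximal (fun T => IsTheory X T ∧ A ∉ T) T

/-- A contradiction; a theory is consistent exactly when it omits this formula. -/
def Formula.falsum : Formula := .and (.var 0) (.neg (.var 0))

theorem isTheory_setOf_derivable (X : Formula) : IsTheory X {A | Derivable X A} :=
  ⟨id, Derivable.mp⟩

namespace IsTheory

variable {X A B C : Formula} {T : Set Formula}

theorem ax (hT : IsTheory X T) (h : IPCAxiom A) : A ∈ T := hT.thm (.ipc h)

theorem and_mem (hT : IsTheory X T) : Formula.and A B ∈ T ↔ A ∈ T ∧ B ∈ T :=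
  ⟨fun h => ⟨hT.mp (hT.ax (.and_left A B)) h, hT.mp (hT.ax (.and_right A B)) h⟩,
    fun h => hT.mp (hT.mp (hT.ax (.and_intro A B)) h.1) h.2⟩

theorem or_mem_left (hT : IsTheory X T) (h : A ∈ T) : Formula.or A B ∈ T :=
  hT.mp (hT.ax (.or_left A B)) h

theorem or_mem_right (hT : IsTheory X T) (h : B ∈ T) : Formula.or A B ∈ T :=
  hT.mp (hT.ax (.or_right A B)) h

theorem imp_mem (hT : IsTheory X T) (h : B ∈ T) : Formula.imp A B ∈ T :=
  hT.mp (hT.ax (.k B A)) h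

theorem imp_self_mem (hT : IsTheory X T) : Formula.imp A A ∈ T :=
  hT.mp (hT.mp (hT.ax (.s A (.imp A A) A)) (hT.ax (.k A (.imp A A)))) (hT.ax (.k A A))

theorem mem_of_neg_mem (hT : IsTheory X T) (h : Formula.neg A ∈ T) (hA : A ∈ T) : B ∈ T :=
  hT.mp (hT.mp (hT.ax (.neg_elim A B)) h) hA

theorem mem_of_falsum_mem (hT : IsTheory X T) (h : Formula.falsum ∈ T) : B ∈ T :=
  hT.mem_of_neg_mem (hT.and_mem.1 h).2 (hT.and_mem.1 h).1

/-- The theory generated by `T` and `A` is `{B | A → B ∈ T}`, by the deduction theorem. -/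
theorem adjoin (hT : IsTheory X T) (A : Formula) : IsTheory X {B | Formula.imp A B ∈ T} :=
  ⟨fun h => hT.imp_mem (hT.thm h), fun {B C} h h' => hT.mp (hT.mp (hT.ax (.s A B C)) h) h'⟩

theorem subset_adjoin (hT : IsTheory X T) (A : Formula) : T ⊆ {B | Formula.imp A B ∈ T} :=
  fun _ h => hT.imp_mem h

theorem exists_notMem_adjoin (hT : IsTheory X T) (h : Formula.neg A ∉ T) :
    ∃ B, B ∉ {B | Formula.imp A B ∈ T} := by
  by_contra! hall
  exact h (hT.mp (hT.mp (hT.ax (.neg_intro A A)) (hall A)) (hall (.neg A)))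

/-- Lindenbaum's lemma. -/
theorem exists_maximalOmitting (hT : IsTheory X T) (hA : A ∉ T) :
    ∃ M, T ⊆ M ∧ MaximalOmitting X A M := by
  refine zorn_subset_nonempty {T | IsTheory X T ∧ A ∉ T} ?_ T ⟨hT, hA⟩
  rintro c hc hchain ⟨S, hS⟩
  refine ⟨⋃₀ c, ⟨⟨fun h => ⟨S, hS, (hc hS).1.thm h⟩, ?_⟩, ?_⟩,
    fun S hS => Set.subset_sUnion_of_mem hS⟩
  · rintro B C ⟨S₁, h₁, hB⟩ ⟨S₂, h₂, hC⟩
    rcases hchain.total h₁ h₂ with h | h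
    · exact ⟨S₂, h₂, (hc h₂).1.mp (h hB) hC⟩
    · exact ⟨S₁, h₁, (hc h₁).1.mp hB (h hC)⟩
  · rintro ⟨S, hS, h⟩
    exact (hc hS).2 h

end IsTheory

namespace MaximalOmitting

variable {X A B C : Formula} {T : Set Formula}

/-- Otherwise adjoining `B` would give a larger theory omitting `A`. -/
theorem imp_mem_of_notMem (h : MaximalOmitting X A T) (hB : B ∉ T) : Formula.imp B A ∈ T := by
  by_contra hA
  exact hB (h.2 ⟨h.1.1.adjoin B, hA⟩ (h.1.1.subset_adjoin B) h.1.1.imp_self_mem)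

theorem isPrimeTheory (h : MaximalOmitting X A T) : IsPrimeTheory X T where
  toIsTheory := h.1.1
  proper := ⟨A, h.1.2⟩
  prime {B C} hBC := by
    by_contra! hn
    have hT := h.1.1
    exact h.1.2 (hT.mp (hT.mp (hT.mp (hT.ax (.or_elim B C A)) (h.imp_mem_of_notMem hn.1))
      (h.imp_mem_of_notMem hn.2)) hBC)

theorem neg_mem (h : MaximalOmitting X .falsum T) : Formula.neg B ∈ T ↔ B ∉ T := by
  refine ⟨fun hn hB => h.1.2 (h.1.1.mem_of_neg_mem hn hB), fun hB => ?_⟩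
  by_contra hn
  obtain ⟨C, hC⟩ := h.1.1.exists_notMem_adjoin hn
  exact hC ((h.1.1.adjoin B).mem_of_falsum_mem (h.imp_mem_of_notMem hB))

theorem eq_of_subset {S : Set Formula} (hT : MaximalOmitting X A T) (hS : MaximalOmitting X A S)
    (h : T ⊆ S) : T = S :=
  h.antisymm (hT.2 hS.1 h)

end MaximalOmitting

namespace IsPrimeTheory

variable {X A B : Formula} {T : Set Formula}

theorem or_mem (hT : IsPrimeTheory X T) : Formula.or A B ∈ T ↔ A ∈ T ∨ B ∈ T :=
  ⟨hT.prime, fun h => h.elim hT.or_mem_left hT.or_mem_right⟩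

theorem falsum_notMem (hT : IsPrimeTheory X T) : Formula.falsum ∉ T := fun h =>
  hT.proper.elim fun _ hA => hA (hT.mem_of_falsum_mem h)

theorem imp_mem_iff (hT : IsPrimeTheory X T) :
    Formula.imp A B ∈ T ↔ ∀ S, IsPrimeTheory X S → T ⊆ S → A ∈ S → B ∈ S := by
  refine ⟨fun h S hS hTS hA => hS.mp (hTS h) hA, fun h => ?_⟩
  by_contra hn
  obtain ⟨S, hTS, hS⟩ := (hT.adjoin A).exists_maximalOmitting hn
  exact hS.1.2 (h S hS.isPrimeTheory ((hT.subset_adjoin A).trans hTS) (hTS hT.imp_self_mem))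

theorem neg_mem_iff (hT : IsPrimeTheory X T) :
    Formula.neg A ∈ T ↔ ∀ S, IsPrimeTheory X S → T ⊆ S → A ∉ S := by
  refine ⟨fun h S hS hTS hA => hS.falsum_notMem (hS.mem_of_neg_mem (hTS h) hA), fun h => ?_⟩
  by_contra hn
  obtain ⟨B, hB⟩ := hT.exists_notMem_adjoin hn
  obtain ⟨S, hTS, hS⟩ := (hT.adjoin A).exists_maximalOmitting hB
  exact h S hS.isPrimeTheory ((hT.subset_adjoin A).trans hTS) (hTS hT.imp_self_mem)

theorem foldr_or_mem (hT : IsPrimeTheory X T) {l : List Formula} :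
    l.foldr .or A ∈ T ↔ (∃ B ∈ l, B ∈ T) ∨ A ∈ T := by
  induction l with
  | nil => simp
  | cons B l ih => simp [hT.or_mem, ih, or_assoc]

end IsPrimeTheory

theorem IsTheory.foldl_and_mem {X A : Formula} {T : Set Formula} (hT : IsTheory X T)
    {l : List Formula} : l.foldl .and A ∈ T ↔ A ∈ T ∧ ∀ B ∈ l, B ∈ T := by
  induction l generalizing A with
  | nil => simp
  | cons B l ih => simp [hT.and_mem, ih, and_assoc]

/-! ### Prime theories over `IPC + φ_k` have few maximal extensions -/

section Separation

variable {X : Formula} {ι : Type*} {M : ι → Set Formula}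

theorem exists_mem_forall_notMem (hM : ∀ i, MaximalOmitting X .falsum (M i))
    (hinj : Function.Injective M) (i : ι) (t : Finset ι) (hi : i ∉ t) :
    ∃ A ∈ M i, ∀ j ∈ t, A ∉ M j := by
  classical
  induction t using Finset.induction_on with
  | empty => exact ⟨_, (hM i).1.1.imp_self_mem (A := .falsum), by simp⟩
  | insert j t _ ih =>
    simp only [Finset.mem_insert, not_or] at hi
    obtain ⟨A, hA, hAt⟩ := ih hi.2
    obtain ⟨B, hB, hBj⟩ := Set.not_subset.1 fun h =>
      hi.1 (hinj ((hM i).eq_of_subset (hM j) h))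
    refine ⟨.and A B, (hM i).1.1.and_mem.2 ⟨hA, hB⟩, fun l hl h => ?_⟩
    have hAB := (hM l).1.1.and_mem.1 h
    rcases Finset.mem_insert.1 hl with rfl | hl
    · exact hBj hAB.2
    · exact hAt l hl hAB.1

/-- Any set of members of a finite family of distinct maximal theories is cut out by a formula. -/
theorem exists_mem_iff [Fintype ι] (hM : ∀ i, MaximalOmitting X .falsum (M i))
    (hinj : Function.Injective M) (t : Finset ι) : ∃ A, ∀ i, A ∈ M i ↔ i ∈ t := by
  classical
  induction t using Finset.induction_on with
  | empty => exact ⟨.falsum, fun i => by simpa using (hM i).1.2⟩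
  | insert j t _ ih =>
    obtain ⟨A, hA⟩ := ih
    obtain ⟨B, hB, hBj⟩ := exists_mem_forall_notMem hM hinj j (Finset.univ.erase j) (by simp)
    refine ⟨.or B A, fun i => ?_⟩
    rw [(hM i).isPrimeTheory.or_mem, hA, Finset.mem_insert]
    refine or_congr_left ⟨fun h => ?_, fun h => h ▸ hB⟩
    by_contra hij
    exact hBj i (by simp [hij]) h

end Separation

/-- Given `n + 1` distinct maximal theories above `T`, pick `k` pairwise incomparable subsets of the
first `n` of them and add the last one to each. Interpreting `p_i` by a formula whose
negation belongs to exactly the maximal theories of the `i`-th set gives an instance of `φ_k` that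
is not in `T`. -/
theorem not_injective_maximal {k n : ℕ} (hk : 1 ≤ k) (hn : 1 ≤ n) (hkn : k ≤ n.choose (n / 2))
    {T : Set Formula} (hT : IsPrimeTheory (Formula.phi k) T) (M : Fin (n + 1) → Set Formula)
    (hM : ∀ i, MaximalOmitting (Formula.phi k) .falsum (M i)) (hTM : ∀ i, T ⊆ M i) :
    ¬ Function.Injective M := by
  classical
  intro hinj
  have hcard : Fintype.card (Fin k) ≤
      Fintype.card (Finset.powersetCard (n / 2) (Finset.univ : Finset (Fin n))) := by
    simpa [Finset.card_powersetCard] using hkn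
  obtain ⟨S⟩ := Function.Embedding.nonempty_of_card_le hcard
  have hS (i j : Fin k) (h : (S i).1 ⊆ (S j).1) : i = j := by
    refine S.injective (Subtype.ext (Finset.eq_of_subset_of_card_le h ?_))
    rw [(Finset.mem_powersetCard.1 (S i).2).2, (Finset.mem_powersetCard.1 (S j).2).2]
  -- `p i` belongs to the maximal theories outside the `i`-th set.
  choose p hp using fun i : Fin k =>
    exists_mem_iff hM hinj ((Finset.univ \ (S i).1).map Fin.castSuccEmb)
  let s (i : ℕ) : Formula := if h : i < k then p ⟨i, h⟩ else .falsum
  have hs (i : Fin k) : s i = p i := by simp [s]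
  have hcast (i : Fin k) (j : Fin n) :
      Formula.neg (s i) ∈ M j.castSucc ↔ j ∈ (S i).1 := by
    rw [(hM _).neg_mem, hs, hp]
    simp
  have hlast (i : Fin k) : Formula.neg (s i) ∈ M (Fin.last n) := by
    rw [(hM _).neg_mem, hs, hp]
    simp [Fin.castSucc_ne_last]
  have hphi : (Formula.phi k).subst s ∈ T := hT.thm (.inst s)
  rw [Formula.phi] at hphi
  split_ifs at hphi with hk1
  · -- `φ₁` has `¬p₁` in place of the implications, so a maximal theory outside the set chosen for
    -- `p₁` is needed; it exists because `n / 2 < n`.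
    subst hk1
    rcases hT.prime hphi with h | h
    · have hlt : (S 0).1 ≠ Finset.univ := fun e => by
        have h2 := (Finset.mem_powersetCard.1 (S 0).2).2
        rw [e, Finset.card_univ, Fintype.card_fin] at h2
        omega
      obtain ⟨j, hj⟩ := not_forall.1 fun hall => hlt (Finset.eq_univ_iff_forall.2 hall)
      exact hj ((hcast 0 j).1 (hTM _ h))
    · exact (hM (Fin.last n)).neg_mem.1 (hTM _ h) (hlast 0)
  · rw [Formula.subst_foldr_or, hT.foldr_or_mem] at hphi
    rcases hphi with ⟨B, hB, hBT⟩ | h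
    · obtain ⟨C, hC, rfl⟩ := List.mem_map.1 hB
      obtain ⟨i, hi, j, hj, hij, rfl⟩ := Formula.mem_negImps.1 hC
      refine hij (congrArg Fin.val (hS ⟨i, hi⟩ ⟨j, hj⟩ fun l hl => ?_))
      exact (hcast ⟨j, hj⟩ l).1 ((hM _).1.1.mp (hTM _ hBT) ((hcast ⟨i, hi⟩ l).2 hl))
    · refine (hM (Fin.last n)).neg_mem.1 (hTM _ h) ?_
      rw [Formula.conjNeg, Formula.subst_foldl_and, (hM _).1.1.foldl_and_mem]
      refine ⟨hlast ⟨0, hk⟩, fun B hB => ?_⟩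
      simp only [List.map_map, List.mem_map, List.mem_range'_1] at hB
      obtain ⟨i, hi, rfl⟩ := hB
      exact hlast ⟨i, by omega⟩

/-- The maximal theories above a prime theory can be listed by `Fin n`, with repetitions. -/
theorem exists_cofinal_maximal {k n : ℕ} (hk : 1 ≤ k) (hn : 1 ≤ n) (hkn : k ≤ n.choose (n / 2))
    {T : Set Formula} (hT : IsPrimeTheory (Formula.phi k) T) :
    ∃ M : Fin n → Set Formula, (∀ i, IsPrimeTheory (Formula.phi k) (M i) ∧ T ⊆ M i) ∧
      ∀ S, IsPrimeTheory (Formula.phi k) S → T ⊆ S → ∃ i, S ⊆ M i := by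
  let 𝓜 := {M // MaximalOmitting (Formula.phi k) .falsum M ∧ T ⊆ M}
  have hno : ¬ Nonempty (Fin (n + 1) ↪ 𝓜) := fun ⟨f⟩ =>
    not_injective_maximal hk hn hkn hT (fun i => (f i).1) (fun i => (f i).2.1)
      (fun i => (f i).2.2) (Subtype.val_injective.comp f.injective)
  have hfin : Finite 𝓜 := by
    by_contra h
    rw [not_finite_iff_infinite] at h
    exact hno ⟨Fin.valEmbedding.trans (Infinite.natEmbedding 𝓜)⟩
  have := Fintype.ofFinite 𝓜
  have hcard : Fintype.card 𝓜 ≤ Fintype.card (Fin n) := by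
    by_contra! h
    exact hno (Function.Embedding.nonempty_of_card_le (by simpa using h))
  obtain ⟨e⟩ := Function.Embedding.nonempty_of_card_le hcard
  have above (S : Set Formula) (hS : IsPrimeTheory (Formula.phi k) S) (hTS : T ⊆ S) :
      ∃ M : 𝓜, S ⊆ M.1 := by
    obtain ⟨M, hSM, hM⟩ := hS.exists_maximalOmitting hS.falsum_notMem
    exact ⟨⟨M, hM, hTS.trans hSM⟩, hSM⟩
  obtain ⟨M₀, -⟩ := above T hT subset_rfl
  have : Nonempty 𝓜 := ⟨M₀⟩
  refine ⟨fun i => (Function.invFun e i).1,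
    fun i => ⟨(Function.invFun e i).2.1.isPrimeTheory, (Function.invFun e i).2.2⟩,
    fun S hS hTS => ?_⟩
  obtain ⟨M, hSM⟩ := above S hS hTS
  exact ⟨e M, by dsimp only; rwa [Function.leftInverse_invFun e.injective M]⟩

/-! ### Finite models coded by natural numbers -/

/-- The numbers `w` and `v` code sets of formulas by their binary digits, the digit in position
`B.code` telling whether `B` belongs to the set. `BitSubset N w v` is inclusion of these sets, for
formulas with code below `N`. -/
def BitSubset (N w v : ℕ) : Prop := ∀ c < N, w.testBit c → v.testBit c

/-- `w` is one of the worlds of the model coded by `W`: the binary digits of `W` tell which sets of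
formulas with code below `N` are worlds. -/
def IsWorld (N W w : ℕ) : Prop := w < 2 ^ N ∧ W.testBit w

/-- In the model coded by `W`, with inclusion as its order, the world `w` contains the formula with
code `c` exactly when the forcing clause for the main connective of that formula says so. -/
def Correct (N W w c : ℕ) : Prop :=
  (c % 5 = 1 → (w.testBit c ↔
    ∀ v < 2 ^ N, W.testBit v → BitSubset N w v → ¬ v.testBit (c / 5))) ∧
  (c % 5 = 2 → (w.testBit c ↔
    w.testBit (c / 5).unpair.1 ∧ w.testBit (c / 5).unpair.2)) ∧
  (c % 5 = 3 → (w.testBit c ↔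
    w.testBit (c / 5).unpair.1 ∨ w.testBit (c / 5).unpair.2)) ∧
  (c % 5 = 4 → (w.testBit c ↔
    ∀ v < 2 ^ N, W.testBit v → BitSubset N w v →
      v.testBit (c / 5).unpair.1 → v.testBit (c / 5).unpair.2))

/-- `W` codes a finite model on a frame of topwidth at most `n` whose root omits the formula with
code `a`. The list of `n` worlds that bounds the topwidth is coded by the base-`2 ^ (a + 1)`
digits of a number `e`. -/
def IsCountermodel (n a W : ℕ) : Prop :=
  (∀ w < 2 ^ (a + 1), W.testBit w → ∀ c < a + 1, Correct (a + 1) W w c) ∧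
  (∃ r < 2 ^ (a + 1), W.testBit r ∧ ¬ r.testBit a ∧
    ∀ w < 2 ^ (a + 1), W.testBit w → BitSubset (a + 1) r w) ∧
  (∃ e < (2 ^ (a + 1)) ^ n, ∀ w < 2 ^ (a + 1), W.testBit w → ∃ i < n,
    W.testBit (e / (2 ^ (a + 1)) ^ i % 2 ^ (a + 1)) ∧
      BitSubset (a + 1) w (e / (2 ^ (a + 1)) ^ i % 2 ^ (a + 1)))

/-- Some finite model on a frame of topwidth at most `n` refutes the formula with code `a`. -/
def Refutable (n a : ℕ) : Prop := ∃ W < 2 ^ 2 ^ (a + 1), IsCountermodel n a W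

theorem BitSubset.antisymm {N w v : ℕ} (hw : w < 2 ^ N) (hv : v < 2 ^ N) (h : BitSubset N w v)
    (h' : BitSubset N v w) : w = v := by
  refine Nat.eq_of_testBit_eq fun c => ?_
  rcases lt_or_ge c N with hc | hc
  · exact Bool.eq_iff_iff.2 ⟨h c hc, h' c hc⟩
  · have hN := Nat.pow_le_pow_right (n := 2) (by norm_num) hc
    rw [Nat.testBit_lt_two_pow (hw.trans_le hN), Nat.testBit_lt_two_pow (hv.trans_le hN)]

/-! ### From codes to frames -/

/-- The worlds of the model coded by `W`, lifted to the universe `u`. -/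
def World (N W : ℕ) : Type u := ULift.{u} {w : ℕ // IsWorld N W w}

/-- Worlds are ordered by inclusion of the coded sets of formulas. -/
instance (N W : ℕ) : PartialOrder (World.{u} N W) where
  le w v := BitSubset N w.down.1 v.down.1
  le_refl _ _ _ h := h
  le_trans _ _ _ h h' c hc hw := h' c hc (h c hc hw)
  le_antisymm w v h h' :=
    ULift.down_injective (Subtype.ext (h.antisymm w.down.2.1 v.down.2.1 h'))

instance (N W : ℕ) : Finite (World.{u} N W) := by
  have : Finite {w : ℕ // IsWorld N W w} :=
    ((Set.finite_Iio (2 ^ N)).subset fun _ h => h.1).to_subtype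
  exact Finite.of_equiv _ Equiv.ulift.symm

/-- The frame of the model coded by `W`. -/
def codedFrame (N W : ℕ) (h : ∃ r : World.{u} N W, ∀ w, r ≤ w) : KripkeFrame.{u} :=
  ⟨World N W, h⟩

/-- The valuation of the model coded by `W`. Variables with code at least `N` are false. -/
def codedValuation (N W : ℕ) (h : ∃ r : World.{u} N W, ∀ w, r ≤ w) :
    (codedFrame N W h).Valuation where
  val i := {w : World N W | (Formula.var i).code < N ∧ w.down.1.testBit (Formula.var i).code}
  mono _ _ _ hx hxy := ⟨hx.1, hxy _ hx.1 hx.2⟩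

theorem Formula.code_lt_left {A B : Formula} {N t : ℕ} (h : 5 * Nat.pair A.code B.code + t < N) :
    A.code < N :=
  (Nat.left_le_pair A.code B.code).trans_lt (by omega)

theorem Formula.code_lt_right {A B : Formula} {N t : ℕ} (h : 5 * Nat.pair A.code B.code + t < N) :
    B.code < N :=
  (Nat.right_le_pair A.code B.code).trans_lt (by omega)

/-- The truth lemma for coded models: a world forces exactly the formulas it contains. -/
theorem forces_codedFrame {N W : ℕ} (h : ∃ r : World.{u} N W, ∀ w, r ≤ w)
    (hW : ∀ w < 2 ^ N, W.testBit w → ∀ c < N, Correct N W w c) (A : Formula)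
    (hA : A.code < N) (w : World.{u} N W) :
    KripkeFrame.Forces (F := codedFrame N W h) (codedValuation N W h) w A ↔
      w.down.1.testBit A.code := by
  have quantify (w : World.{u} N W) (P : ℕ → Prop) :
      (∀ v : World.{u} N W, w ≤ v → P v.down.1) ↔
        ∀ v < 2 ^ N, W.testBit v → BitSubset N w.down.1 v → P v :=
    ⟨fun H v hv hv' hwv => H ⟨v, hv, hv'⟩ hwv, fun H v hwv => H _ v.down.2.1 v.down.2.2 hwv⟩
  induction A generalizing w with
  | var i => exact ⟨fun h => h.2, fun h => ⟨hA, h⟩⟩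
  | neg A ih =>
    have hc := (hW _ w.down.2.1 w.down.2.2 _ hA).1
    simp only [Formula.code] at hc hA ⊢
    rw [hc (by omega), show (5 * A.code + 1) / 5 = A.code by omega, ← quantify]
    simp only [KripkeFrame.Forces, not_exists, not_and]
    exact forall_congr' fun v => imp_congr_right fun _ => not_congr (ih (by omega) v)
  | and A B ihA ihB =>
    have hc := (hW _ w.down.2.1 w.down.2.2 _ hA).2.1
    simp only [Formula.code] at hc hA ⊢
    rw [hc (by omega), show (5 * Nat.pair A.code B.code + 2) / 5 = Nat.pair A.code B.code by omega,
      Nat.unpair_pair]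
    exact and_congr (ihA (Formula.code_lt_left hA) w) (ihB (Formula.code_lt_right hA) w)
  | or A B ihA ihB =>
    have hc := (hW _ w.down.2.1 w.down.2.2 _ hA).2.2.1
    simp only [Formula.code] at hc hA ⊢
    rw [hc (by omega), show (5 * Nat.pair A.code B.code + 3) / 5 = Nat.pair A.code B.code by omega,
      Nat.unpair_pair]
    exact or_congr (ihA (Formula.code_lt_left hA) w) (ihB (Formula.code_lt_right hA) w)
  | imp A B ihA ihB =>
    have hc := (hW _ w.down.2.1 w.down.2.2 _ hA).2.2.2
    simp only [Formula.code] at hc hA ⊢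
    rw [hc (by omega), show (5 * Nat.pair A.code B.code + 4) / 5 = Nat.pair A.code B.code by omega,
      Nat.unpair_pair, ← quantify]
    exact forall_congr' fun v => imp_congr_right fun _ =>
      imp_congr (ihA (Formula.code_lt_left hA) v) (ihB (Formula.code_lt_right hA) v)

theorem not_refutable_of_holds {n : ℕ} {A : Formula}
    (h : ∀ F : KripkeFrame.{u}, Finite F.carrier → F.TopwidthAtMost n → F.Holds A) :
    ¬ Refutable n A.code := by
  rintro ⟨W, -, hW, ⟨r, hr, hrW, hrA, hroot⟩, e, -, he⟩
  have hroot' : ∃ r : World.{u} (A.code + 1) W, ∀ w, r ≤ w :=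
    ⟨⟨r, hr, hrW⟩, fun w => hroot _ w.down.2.1 w.down.2.2⟩
  let F := codedFrame (A.code + 1) W hroot'
  have hfin : Finite F.carrier := inferInstanceAs (Finite (World _ _))
  let digit (i : ℕ) : ℕ := e / (2 ^ (A.code + 1)) ^ i % 2 ^ (A.code + 1)
  -- Digits of `e` that are not worlds are replaced by the root.
  let f (i : Fin n) : F.carrier :=
    if hi : W.testBit (digit i) then ⟨digit i, Nat.mod_lt _ (by positivity), hi⟩
    else ⟨r, hr, hrW⟩
  have htw : F.TopwidthAtMost n := by
    refine KripkeFrame.topwidthAtMost_of_cofinal f fun w => ?_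
    obtain ⟨i, hi, hiW, hwi⟩ := he _ w.down.2.1 w.down.2.2
    have hfi : f ⟨i, hi⟩ = ⟨digit i, Nat.mod_lt _ (by positivity), hiW⟩ := dif_pos hiW
    exact ⟨⟨i, hi⟩, hfi ▸ hwi⟩
  exact hrA ((forces_codedFrame hroot' hW A (Nat.lt_succ_self _) ⟨r, hr, hrW⟩).1
    (h F hfin htw _ _))

/-! ### From prime theories to codes -/

/-- Every set of numbers below `N` is the set of binary digits of some number. -/
theorem exists_testBit_iff (N : ℕ) (p : ℕ → Prop) :
    ∃ w < 2 ^ N, ∀ c < N, w.testBit c ↔ p c := by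
  classical
  exact ⟨Nat.ofBits fun i : Fin N => decide (p i), Nat.ofBits_lt_two_pow _, fun c hc => by
    simp [Nat.testBit_ofBits_lt _ c hc]⟩

/-- Filtration of the canonical model above a prime theory `T` omitting `A`: the worlds are the
traces of the prime theories extending `T` on the formulas with code at most that of `A`. Every
world lies below the trace of a maximal theory, so the topwidth does not grow. -/
theorem refutable_of_not_derivable {k n : ℕ} (hk : 1 ≤ k) (hn : 1 ≤ n)
    (hkn : k ≤ n.choose (n / 2)) {A : Formula} (hA : ¬ Derivable (Formula.phi k) A) :
    Refutable n A.code := by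
  classical
  set X := Formula.phi k
  obtain ⟨T, -, hT⟩ := (isTheory_setOf_derivable X).exists_maximalOmitting hA
  have hAT : A ∉ T := hT.1.2
  replace hT := hT.isPrimeTheory
  obtain ⟨M, hM, hTM⟩ := exists_cofinal_maximal hk hn hkn hT
  set N := A.code + 1 with hN
  choose trace htrace_lt htrace using fun S : Set Formula =>
    exists_testBit_iff N fun c => Formula.ofCode c ∈ S
  have mem (S : Set Formula) {B : Formula} (hB : B.code < N) :
      (trace S).testBit B.code ↔ B ∈ S := by
    rw [htrace S _ hB, Formula.ofCode_code]
  obtain ⟨W, hW_lt, hW⟩ := exists_testBit_iff (2 ^ N) fun w =>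
    ∃ S, IsPrimeTheory X S ∧ T ⊆ S ∧ trace S = w
  have hWtrace {S : Set Formula} (hS : IsPrimeTheory X S) (hTS : T ⊆ S) :
      W.testBit (trace S) := (hW _ (htrace_lt S)).2 ⟨S, hS, hTS, rfl⟩
  have htrace_mono {S S' : Set Formula} (h : S ⊆ S') : BitSubset N (trace S) (trace S') :=
    fun c hc hS => (htrace S' c hc).2 (h ((htrace S c hc).1 hS))
  have mem_of_bitSubset {S S' : Set Formula} (h : BitSubset N (trace S) (trace S'))
      {B : Formula} (hB : B.code < N) (hBS : B ∈ S) : B ∈ S' :=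
    (mem S' hB).1 (h _ hB ((mem S hB).2 hBS))
  refine ⟨W, hW_lt, ?_, ⟨trace T, htrace_lt T, hWtrace hT subset_rfl, ?_, ?_⟩, ?_⟩
  · intro w hw hwW c hc
    obtain ⟨S, hS, hTS, rfl⟩ := (hW w hw).1 hwW
    obtain ⟨B, rfl⟩ : ∃ B : Formula, B.code = c := ⟨_, Formula.code_ofCode c⟩
    have hB := mem S hc
    cases B with
    | var i => simp only [Formula.code, Correct]; omega
    | neg B =>
      simp only [Formula.code] at hB hc ⊢
      refine ⟨fun _ => ?_, by omega, by omega, by omega⟩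
      rw [hB, show (5 * B.code + 1) / 5 = B.code by omega]
      constructor
      · intro hBS v hv hvW hSv hvB
        obtain ⟨S', hS', -, rfl⟩ := (hW v hv).1 hvW
        exact hS'.neg_mem_iff.1 (mem_of_bitSubset hSv hc hBS) S' hS' subset_rfl
          ((mem S' (by omega)).1 hvB)
      · intro h
        refine hS.neg_mem_iff.2 fun S' hS' hSS' hBS' => ?_
        exact h _ (htrace_lt S') (hWtrace hS' (hTS.trans hSS')) (htrace_mono hSS')
          ((mem S' (by omega)).2 hBS')
    | and B C =>
      simp only [Formula.code] at hB hc ⊢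
      refine ⟨by omega, fun _ => ?_, by omega, by omega⟩
      rw [hB, show (5 * Nat.pair B.code C.code + 2) / 5 = Nat.pair B.code C.code by omega,
        Nat.unpair_pair, mem S (Formula.code_lt_left hc), mem S (Formula.code_lt_right hc),
        hS.and_mem]
    | or B C =>
      simp only [Formula.code] at hB hc ⊢
      refine ⟨by omega, by omega, fun _ => ?_, by omega⟩
      rw [hB, show (5 * Nat.pair B.code C.code + 3) / 5 = Nat.pair B.code C.code by omega,
        Nat.unpair_pair, mem S (Formula.code_lt_left hc), mem S (Formula.code_lt_right hc),
        hS.or_mem]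
    | imp B C =>
      simp only [Formula.code] at hB hc ⊢
      refine ⟨by omega, by omega, by omega, fun _ => ?_⟩
      rw [hB, show (5 * Nat.pair B.code C.code + 4) / 5 = Nat.pair B.code C.code by omega,
        Nat.unpair_pair]
      have hBN := Formula.code_lt_left hc
      have hCN := Formula.code_lt_right hc
      constructor
      · intro hBC v hv hvW hSv hvB
        obtain ⟨S', hS', -, rfl⟩ := (hW v hv).1 hvW
        exact (mem S' hCN).2 (hS'.mp (mem_of_bitSubset hSv hc hBC) ((mem S' hBN).1 hvB))
      · intro h
        refine hS.imp_mem_iff.2 fun S' hS' hSS' hBS' => ?_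
        exact (mem S' hCN).1 (h _ (htrace_lt S') (hWtrace hS' (hTS.trans hSS'))
          (htrace_mono hSS') ((mem S' hBN).2 hBS'))
  · rwa [mem T (Nat.lt_succ_self _)]
  · intro w hw hwW
    obtain ⟨S, -, hTS, rfl⟩ := (hW w hw).1 hwW
    exact htrace_mono hTS
  · let e : Fin ((2 ^ N) ^ n) :=
      finFunctionFinEquiv fun i : Fin n => (⟨trace (M i), htrace_lt _⟩ : Fin (2 ^ N))
    have he (i : Fin n) : (e : ℕ) / (2 ^ N) ^ (i : ℕ) % 2 ^ N = trace (M i) :=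
      congrArg Fin.val (congrFun (finFunctionFinEquiv.symm_apply_apply
        fun i : Fin n => (⟨trace (M i), htrace_lt _⟩ : Fin (2 ^ N))) i)
    refine ⟨e, e.2, fun w hw hwW => ?_⟩
    obtain ⟨S, hS, hTS, rfl⟩ := (hW w hw).1 hwW
    obtain ⟨i, hi⟩ := hTM S hS hTS
    refine ⟨i, i.2, ?_⟩
    rw [he]
    exact ⟨hWtrace (hM i).1 (hM i).2, htrace_mono hi⟩

end IntProp

/-! ### Decidability -/

section Primrec

variable {α : Type*} [Primcodable α]

theorem PrimrecPred.implies {p q : α → Prop} (hp : PrimrecPred p) (hq : PrimrecPred q) :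
    PrimrecPred fun x => p x → q x :=
  (hp.not.or hq).of_eq fun _ => imp_iff_not_or.symm

theorem PrimrecPred.iff_iff {p q : α → Prop} (hp : PrimrecPred p) (hq : PrimrecPred q) :
    PrimrecPred fun x => p x ↔ q x :=
  ((PrimrecPred.implies hp hq).and (PrimrecPred.implies hq hp)).of_eq fun _ => iff_def.symm

theorem PrimrecPred.forall_lt_comp {f : α → ℕ} {p : α → ℕ → Prop} (hf : Primrec f)
    (hp : PrimrecPred fun x : α × ℕ => p x.1 x.2) : PrimrecPred fun x => ∀ i < f x, p x i :=
  ((PrimrecRel.forall_mem_list (R := fun i x => p x i)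
    (hp.comp (Primrec.snd.pair Primrec.fst))).comp (Primrec.list_range.comp hf)
      Primrec.id).of_eq fun x => by simp

theorem PrimrecPred.exists_lt_comp {f : α → ℕ} {p : α → ℕ → Prop} (hf : Primrec f)
    (hp : PrimrecPred fun x : α × ℕ => p x.1 x.2) : PrimrecPred fun x => ∃ i < f x, p x i :=
  ((PrimrecRel.exists_mem_list (R := fun i x => p x i)
    (hp.comp (Primrec.snd.pair Primrec.fst))).comp (Primrec.list_range.comp hf)
      Primrec.id).of_eq fun x => by simp

theorem Primrec.natPow {f g : α → ℕ} (hf : Primrec f) (hg : Primrec g) :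
    Primrec fun x => f x ^ g x :=
  (Primrec₂.unpaired'.1 Nat.Primrec.pow).comp hf hg

theorem PrimrecPred.testBit {f g : α → ℕ} (hf : Primrec f) (hg : Primrec g) :
    PrimrecPred fun x => (f x).testBit (g x) = true :=
  (Primrec.eq.comp (Primrec.nat_mod.comp (Primrec.nat_div.comp hf
    (Primrec.natPow (Primrec.const 2) hg)) (Primrec.const 2)) (Primrec.const 1)).of_eq
    fun x => by simp [Nat.testBit_eq_decide_div_mod_eq]

end Primrec

namespace IntProp

section Primrec

variable {α : Type*} [Primcodable α]

theorem primrecPred_bitSubset {f g h : α → ℕ} (hf : Primrec f) (hg : Primrec g)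
    (hh : Primrec h) : PrimrecPred fun x => BitSubset (f x) (g x) (h x) :=
  PrimrecPred.forall_lt_comp hf <| PrimrecPred.implies
    (PrimrecPred.testBit (hg.comp Primrec.fst) Primrec.snd)
    (PrimrecPred.testBit (hh.comp Primrec.fst) Primrec.snd)

theorem primrecPred_correct {fN fW fw fc : α → ℕ} (hN : Primrec fN) (hW : Primrec fW)
    (hw : Primrec fw) (hc : Primrec fc) :
    PrimrecPred fun x => Correct (fN x) (fW x) (fw x) (fc x) := by
  have hq : Primrec fun x => fc x / 5 := Primrec.nat_div.comp hc (Primrec.const 5)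
  have h₁ : Primrec fun x => (fc x / 5).unpair.1 := Primrec.fst.comp (Primrec.unpair.comp hq)
  have h₂ : Primrec fun x => (fc x / 5).unpair.2 := Primrec.snd.comp (Primrec.unpair.comp hq)
  have hmod (t : ℕ) : PrimrecPred fun x => fc x % 5 = t :=
    Primrec.eq.comp (Primrec.nat_mod.comp hc (Primrec.const 5)) (Primrec.const t)
  have hpow : Primrec fun x => 2 ^ fN x := Primrec.natPow (Primrec.const 2) hN
  have hbit {f : α → ℕ} (hf : Primrec f) : PrimrecPred fun x => (fw x).testBit (f x) = true :=
    PrimrecPred.testBit hw hf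
  have hvbit {f : α → ℕ} (hf : Primrec f) :
      PrimrecPred fun x : α × ℕ => x.2.testBit (f x.1) = true :=
    PrimrecPred.testBit Primrec.snd (hf.comp Primrec.fst)
  have hall {p : α → ℕ → Prop} (hp : PrimrecPred fun x : α × ℕ => p x.1 x.2) :
      PrimrecPred fun x =>
        ∀ v < 2 ^ fN x, (fW x).testBit v → BitSubset (fN x) (fw x) v → p x v :=
    PrimrecPred.forall_lt_comp hpow <| PrimrecPred.implies
      (PrimrecPred.testBit (hW.comp Primrec.fst) Primrec.snd) <| PrimrecPred.implies
      (primrecPred_bitSubset (hN.comp Primrec.fst) (hw.comp Primrec.fst) Primrec.snd) hp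
  exact (PrimrecPred.implies (hmod 1) (PrimrecPred.iff_iff (hbit hc) (hall (hvbit hq).not))).and
    ((PrimrecPred.implies (hmod 2) (PrimrecPred.iff_iff (hbit hc) ((hbit h₁).and (hbit h₂)))).and
    ((PrimrecPred.implies (hmod 3) (PrimrecPred.iff_iff (hbit hc) ((hbit h₁).or (hbit h₂)))).and
    (PrimrecPred.implies (hmod 4) (PrimrecPred.iff_iff (hbit hc)
      (hall (PrimrecPred.implies (hvbit h₁) (hvbit h₂)))))))

theorem primrecPred_isCountermodel (n : ℕ) {fa fW : α → ℕ} (ha : Primrec fa) (hW : Primrec fW) :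
    PrimrecPred fun x => IsCountermodel n (fa x) (fW x) := by
  have hN : Primrec fun x => fa x + 1 := Primrec.succ.comp ha
  have hpow : Primrec fun x => 2 ^ (fa x + 1) := Primrec.natPow (Primrec.const 2) hN
  have hWbit : PrimrecPred fun x : α × ℕ => (fW x.1).testBit x.2 = true :=
    PrimrecPred.testBit (hW.comp Primrec.fst) Primrec.snd
  refine PrimrecPred.and ?_ (PrimrecPred.and ?_ ?_)
  · refine PrimrecPred.forall_lt_comp hpow (PrimrecPred.implies hWbit
      (PrimrecPred.forall_lt_comp (hN.comp Primrec.fst) ?_))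
    exact primrecPred_correct (hN.comp (Primrec.fst.comp Primrec.fst))
      (hW.comp (Primrec.fst.comp Primrec.fst)) (Primrec.snd.comp Primrec.fst) Primrec.snd
  · refine PrimrecPred.exists_lt_comp hpow (hWbit.and (PrimrecPred.and
      (PrimrecPred.testBit Primrec.snd (ha.comp Primrec.fst)).not
      (PrimrecPred.forall_lt_comp (hpow.comp Primrec.fst) (PrimrecPred.implies ?_ ?_))))
    · exact PrimrecPred.testBit (hW.comp (Primrec.fst.comp Primrec.fst)) Primrec.snd
    · exact primrecPred_bitSubset (hN.comp (Primrec.fst.comp Primrec.fst))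
        (Primrec.snd.comp Primrec.fst) Primrec.snd
  · refine PrimrecPred.exists_lt_comp (Primrec.natPow hpow (Primrec.const n))
      (PrimrecPred.forall_lt_comp (hpow.comp Primrec.fst) (PrimrecPred.implies
        (PrimrecPred.testBit (hW.comp (Primrec.fst.comp Primrec.fst)) Primrec.snd)
        (PrimrecPred.exists_lt_comp (Primrec.const n) ?_)))
    have hbase : Primrec fun x : ((α × ℕ) × ℕ) × ℕ => 2 ^ (fa x.1.1.1 + 1) :=
      hpow.comp (Primrec.fst.comp (Primrec.fst.comp Primrec.fst))
    have hdigit : Primrec fun x : ((α × ℕ) × ℕ) × ℕ =>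
        x.1.1.2 / (2 ^ (fa x.1.1.1 + 1)) ^ x.2 % 2 ^ (fa x.1.1.1 + 1) :=
      Primrec.nat_mod.comp (Primrec.nat_div.comp
        (Primrec.snd.comp (Primrec.fst.comp Primrec.fst)) (Primrec.natPow hbase Primrec.snd)) hbase
    exact (PrimrecPred.testBit (hW.comp (Primrec.fst.comp (Primrec.fst.comp Primrec.fst)))
      hdigit).and (primrecPred_bitSubset
        (hN.comp (Primrec.fst.comp (Primrec.fst.comp Primrec.fst)))
        (Primrec.snd.comp Primrec.fst) hdigit)

end Primrec

theorem primrecPred_refutable (n : ℕ) : PrimrecPred (Refutable n) :=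
  PrimrecPred.exists_lt_comp
    (Primrec.natPow (Primrec.const 2) (Primrec.natPow (Primrec.const 2) Primrec.succ))
    (primrecPred_isCountermodel n Primrec.fst Primrec.snd)

theorem derivable_of_not_refutable {k n : ℕ} (hk : 1 ≤ k)
    (hn : IsLeast {m : ℕ | 1 ≤ m ∧ k ≤ m.choose (m / 2)} n) {A : Formula}
    (h : ¬ Refutable n A.code) : Derivable (Formula.phi k) A := by
  by_contra hA
  exact h (refutable_of_not_derivable hk hn.1.1 hn.1.2 hA)

theorem completeFor_phi {k n : ℕ} (hk : 1 ≤ k)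
    (hn : IsLeast {m : ℕ | 1 ≤ m ∧ k ≤ m.choose (m / 2)} n) :
    CompleteFor (Formula.phi k)
      {F : KripkeFrame.{u} | Finite F.carrier ∧ F.TopwidthAtMost n} := fun _ =>
  ⟨fun h _ hF => KripkeFrame.holds_of_derivable (KripkeFrame.holds_phi hk hn hF.2) h,
    fun h => derivable_of_not_refutable hk hn
      (not_refutable_of_holds fun F hfin htw => h F ⟨hfin, htw⟩)⟩

theorem derivable_iff_not_refutable {k n : ℕ} (hk : 1 ≤ k)
    (hn : IsLeast {m : ℕ | 1 ≤ m ∧ k ≤ m.choose (m / 2)} n) (A : Formula) :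
    Derivable (Formula.phi k) A ↔ ¬ Refutable n A.code :=
  ⟨fun h => not_refutable_of_holds.{0} fun F hfin htw =>
      (completeFor_phi hk hn A).1 h F ⟨hfin, htw⟩,
    derivable_of_not_refutable hk hn⟩

theorem decidableLogic_phi {k : ℕ} (hk : 1 ≤ k) : DecidableLogic (Formula.phi k) := by
  classical
  have hne : ∃ m : ℕ, 1 ≤ m ∧ k ≤ m.choose (m / 2) :=
    ⟨k, hk, by simpa using Nat.choose_le_middle 1 k⟩
  have hn : IsLeast {m : ℕ | 1 ≤ m ∧ k ≤ m.choose (m / 2)} (Nat.find hne) :=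
    ⟨Nat.find_spec hne, fun _ hm => Nat.find_min' hne hm⟩
  -- The encoding of formulas underlying computability is `Formula.code`.
  have henc : Primrec Formula.code := Primrec.encode
  refine ⟨inferInstance, Primrec.to_comp (PrimrecPred.decide ?_)⟩
  exact ((primrecPred_refutable (Nat.find hne)).not.comp henc).of_eq fun A =>
    (derivable_iff_not_refutable hk hn A).symm

end IntProp

theorem mainTheorem2 (k : ℕ) (hk : 1 ≤ k) :
    (∀ n : ℕ, IsLeast {m : ℕ | 1 ≤ m ∧ k ≤ m.choose (m / 2)} n →
      IntProp.CompleteFor (IntProp.Formula.phi k)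
        {F : IntProp.KripkeFrame.{u} | Finite F.carrier ∧ F.TopwidthAtMost n}) ∧
    IntProp.DecidableLogic (IntProp.Formula.phi k) :=
  ⟨fun _ hn => IntProp.completeFor_phi hk hn, IntProp.decidableLogic_phi hk⟩
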